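/- Let $d\ge 1$. A binary cellular automaton on $\mathbb Z^d$ is given by a finite neighborhood $\mathcal N\subset\mathbb Z^d$ and a function $\phi:\{0,1\}^{\mathcal N}\to\{0,1\}$; its global map is $\Phi(\eta)(x)=\phi\big((\eta(x+n))_{n\in\mathcal N}\big)$. Let $\eta\in\{0,1\}^{\mathbb Z^d}$ be doubly periodic: $\pi\ge1$ is the smallest integer with $\Phi^\pi(\eta)=\eta$, and $\sigma\ge1$ is the smallest integer with $\eta(x)=\eta(x \bmod \sigma)$ for all $x$ (coordinatewise reduction). Put $\xi_t=\Phi^t(\eta)$. For $D\subset\mathbb Z^d$ define defect counts by $\Delta_0=\mathbf 1_D$ and $$\Delta_{t+1}(x)=\sum_{y\in x+\mathcal N}\mathbf 1\big(\Phi(\xi_t^{(y)})(x)\ne \xi_{t+1}(x)\big)\,\Delta_t(y),$$ where $\xi^{(y)}$ is $\xi$ flipped at the single site $y$, and let $\delta_t=\{x:\Delta_t(x)>0\}$ be the defect set started from $\delta_0=D$. Assume that $\eta$ is irreducible: the $0$-$1$ matrix $K$ on $\mathbb Z_\sigma^d$, with $K(p,q)=1$ exactly when $\delta_0=\{p\}$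 yields a point of $\delta_\pi$ congruent to $q$ modulo $\sigma$, is irreducible (for all $p,q$ there is $k\ge 1$ with $K^k(p,q)>0$). Assume also that $\eta$ is strongly irreducible with vector $a\in\mathbb Z^d$: for every $x_0\in\mathbb Z^d$, $\delta_0=\{x_0\}$ yields $\bigcup_{t\ge0}(\delta_t-ta)=\mathbb Z^d$. Write $\delta^a_t=\delta_t-ta$ for the defect set in the frame moving with $a$ (so $\delta_t^a=\delta_t$ if $a=0$). For a unit vector $u\in\mathcal S^{d-1}$ let $H_u^-=\{x\in\mathbb R^d:\langle x,u\rangle\le 0\}$. Then for every $u\in\mathcal S^{d-1}$ there is a number $w(u)\ge 0$ (the half-space velocity) such that, if $\delta_0=H_u^-\cap\mathbb Z^d$, then $$t^{-1}\delta^a_t\to w(u)u+H_u^-\qquad (t\to\infty)$$ in the Hausdorff metric. Moreover, let $$K_{1/w}=\bigcup_{u\in\mathcal S^{d-1}}\{\alpha u:0\le\alpha\le 1/w(u)\}$$ (the Frank diagram, where $1/0=\infty$). Then, whenever $\delta_0$ is a lattice box $c+\{0,\dots,\sigma-1\}^d$, $c\in\mathbb Z^d$, every $\delta_t$ is nonempty,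 and the defect shape $W=\lim_{t\to\infty}t^{-1}\delta^a_t$ exists as a closed Hausdorff limit and equals the polar transform of $K_{1/w}$: $$W=K_{1/w}^*=\{x\in\mathbb R^d:\langle x,y\rangle\le 1\text{ for all }y\in K_{1/w}\}=\{x\in\mathbb R^d:\langle x,u\rangle\le w(u)\text{ for all }u\in\mathcal S^{d-1}\}.$$ Finally, $K_{1/w}$ is a convex polytope (a convex polygon if $d=2$): the convex hull of finitely many points, with nonempty interior. -/

import Mathlib

open Filter Topology

noncomputable section

namespace DefectCA

/-- Sites of the lattice `ℤ^d`. -/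
abbrev Site (d : ℕ) := Fin d → ℤ

/-- Binary configurations on `ℤ^d`. -/
abbrev Config (d : ℕ) := Site d → Bool

/-- A binary cellular automaton on `ℤ^d`: a finite neighborhood and an update function, whose
arguments are labelled by the elements of the neighborhood. -/
structure CA (d : ℕ) where
  nbhd : Finset (Site d)
  update : (nbhd → Bool) → Bool

variable {d : ℕ}

/-- The global function `Φ`. -/
def CA.globalMap (A : CA d) (η : Config d) : Config d :=
  fun x => A.update (fun n => η (x + n))

/-- The trajectory `ξ_t` of the automaton from `ξ_0 = η`. -/
def CA.trajectory (A : CA d) (η : Config d) (t : ℕ) : Config d :=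
  A.globalMap^[t] η

/-- The configuration `η` flipped at the single site `y`. -/
def perturb (η : Config d) (y : Site d) : Config d :=
  Function.update η y (!(η y))

open Classical in
/-- `change A η t y x` is `1` if flipping `ξ_t` at `y` changes the state produced at `x` at the
next time, and `0` otherwise. -/
def CA.change (A : CA d) (η : Config d) (t : ℕ) (y x : Site d) : ℕ :=
  if A.globalMap (perturb (A.trajectory η t) y) x ≠ A.trajectory η (t + 1) x then 1 else 0

open Classical in
/-- The number `Δ_t(x)` of defects, for `ξ_0 = η` and one initial defect at each site of `D`. -/
def CA.defectCount (A : CA d) (η : Config d) (D : Set (Site d)) : ℕ → Site d → ℕ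
  | 0 => fun x => if x ∈ D then 1 else 0
  | t + 1 => fun x =>
      ∑ n ∈ A.nbhd, A.change η t (x + n) x * A.defectCount η D t (x + n)

/-- The set `δ_t` of sites with at least one defect, for `ξ_0 = η` and `δ_0 = D`. -/
def CA.defectSet (A : CA d) (η : Config d) (D : Set (Site d)) (t : ℕ) : Set (Site d) :=
  {x | 0 < A.defectCount η D t x}

/-- The defect set at time `t` seen in the frame moving by `a` at each step:
`{x | x + t a ∈ δ_t}`. For `a = 0` this is `δ_t`. -/
def CA.movingDefectSet (A : CA d) (η : Config d) (a : Site d) (D : Set (Site d)) (t : ℕ) :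
    Set (Site d) :=
  {x | x + t • a ∈ A.defectSet η D t}

/-- `η` is doubly periodic, with (smallest) temporal period `π` and (smallest) spatial
period `σ`. -/
def CA.IsDoublyPeriodic (A : CA d) (η : Config d) (π σ : ℕ) : Prop :=
  IsLeast {p : ℕ | 1 ≤ p ∧ A.globalMap^[p] η = η} π ∧
  IsLeast {s : ℕ | 1 ≤ s ∧ ∀ x : Site d, η x = η (fun i => x i % (s : ℤ))} σ

open Classical in
/-- The reduced kernel `K` on `ℤ_σ^d`: `K a b = 1` if a single defect at `a` at time `0` yields at
time `π` a defect at some site congruent to `b` modulo `σ`. -/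
def CA.reducedKernel (A : CA d) (η : Config d) (π σ : ℕ) :
    Matrix (Fin d → ZMod σ) (Fin d → ZMod σ) ℝ :=
  fun a b =>
    if ∃ x ∈ A.defectSet η {fun i => ((a i).val : ℤ)} π, (fun i => (x i : ZMod σ)) = b
    then 1 else 0

/-- Irreducibility of a doubly periodic `η`: its reduced kernel is an irreducible matrix. -/
def CA.IsIrreducible (A : CA d) (η : Config d) (π σ : ℕ) : Prop :=
  (A.reducedKernel η π σ).IsIrreducible

/-- The strong irreducibility condition with the vector `a`: from every single initial defect,
every site is visited at some time in the frame moving by `a` at each step. -/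
def CA.IsStronglyIrreducible (A : CA d) (η : Config d) (a : Site d) : Prop :=
  ∀ x₀ : Site d, ⋃ t : ℕ, A.movingDefectSet η a {x₀} t = Set.univ

/-- The inclusion `ℤ^d → ℝ^d`. -/
def toSpace (x : Site d) : EuclideanSpace ℝ (Fin d) :=
  WithLp.toLp 2 (fun i => (x i : ℝ))

/-- The set `t⁻¹ S ⊆ ℝ^d`, for `S ⊆ ℤ^d`. -/
def rescale (t : ℕ) (S : Set (Site d)) : Set (EuclideanSpace ℝ (Fin d)) :=
  (fun x => (t : ℝ)⁻¹ • toSpace x) '' S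

/-- Convergence `t⁻¹ S_t → W` in the Hausdorff (extended) metric. -/
def HausdorffLimit (S : ℕ → Set (Site d)) (W : Set (EuclideanSpace ℝ (Fin d))) : Prop :=
  Tendsto (fun t : ℕ => Metric.hausdorffEDist (rescale t (S t)) W) atTop (𝓝 0)

/-- `W` is the defect shape of the sets `S_t`: the closed Hausdorff limit of `t⁻¹ S_t`, with the
convention that `W = ∅` if some `S_t` is empty. -/
def IsDefectShape (S : ℕ → Set (Site d)) (W : Set (EuclideanSpace ℝ (Fin d))) : Prop :=
  ((∃ t, S t = ∅) ∧ W = ∅) ∨ ((∀ t, (S t).Nonempty) ∧ IsClosed W ∧ HausdorffLimit S W)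

/-- The lattice box (for `d = 2`, square) of side `σ` with lowest corner `c`. -/
def box (c : Site d) (σ : ℕ) : Set (Site d) :=
  {x | ∀ i, c i ≤ x i ∧ x i < c i + σ}

/-- The unit sphere `𝒮^{d-1}` of directions. -/
abbrev Dir (d : ℕ) := Metric.sphere (0 : EuclideanSpace ℝ (Fin d)) 1

/-- The half-space `H_u^-`. -/
def halfSpace (u : Dir d) : Set (EuclideanSpace ℝ (Fin d)) :=
  {x | inner ℝ x (u : EuclideanSpace ℝ (Fin d)) ≤ 0}

/-- The lattice half-space `H_u^- ∩ ℤ^d`. -/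
def latticeHalfSpace (u : Dir d) : Set (Site d) :=
  {x | toSpace x ∈ halfSpace u}

/-- The Frank diagram `K_{1/w}`, the union over `u` of the segments `{α u : 0 ≤ α ≤ 1 / w u}`.
The bound is written `α * w u ≤ 1`, so that `1 / w u` is read as `∞` where `w u = 0`. -/
def frankDiagram (w : Dir d → ℝ) : Set (EuclideanSpace ℝ (Fin d)) :=
  ⋃ u : Dir d, {y | ∃ α : ℝ, 0 ≤ α ∧ α * w u ≤ 1 ∧ y = α • (u : EuclideanSpace ℝ (Fin d))}

/-- The polar transform `K^*`. -/
def polarTransform (K : Set (EuclideanSpace ℝ (Fin d))) : Set (EuclideanSpace ℝ (Fin d)) :=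
  {x | ∀ y ∈ K, inner ℝ x y ≤ 1}

/-- `K` is a (full-dimensional) convex polytope; for `d = 2`, a convex polygon. -/
def IsConvexPolytope (K : Set (EuclideanSpace ℝ (Fin d))) : Prop :=
  (∃ V : Finset (EuclideanSpace ℝ (Fin d)), K = convexHull ℝ (V : Set _)) ∧ (interior K).Nonempty

end DefectCA

end

open Filter Topology

noncomputable section

namespace DefectCA

variable {d : ℕ}

/-! ### Lattice sites and their residue classes -/

section Lattice

/-! A site carries a defect exactly when a chain of single-site influences reaches it from an
initial defect, so it suffices to follow chains from one site. Sampled once per temporal period and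
reduced modulo σ, such a chain is a walk on a finite graph, strongly connected by irreducibility.
Let V be the finite set of mean velocities of closed walks of at most σ^d periods, and P the convex
hull of V - a.

Up to an error independent of t, the defects of a single site y at time t, in the moving frame, fill
y + tP. They stay close to it because a long chain splits into short cycles and a bounded remainder
(`exists_velocity_approx`). They come close to each of its points because cycles can be repeated,
joined by connections of bounded length, and mixed in any proportion (`exists_attains`).

Hence a box has shape P, and a half-space moves with the support function w(u) of P. Strong
irreducibility forces w > 0. Then the Frank diagram is the bounded polyhedron of all y with ⟨y, k⟩ ≤
1 for k in V - a, thus a polytope, and its polar is the intersection of the supporting half-spaces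
of P, which is P by Hahn–Banach. -/

@[simp]
lemma toSpace_zero : toSpace (0 : Site d) = 0 := by
  ext i; simp [toSpace]

@[simp]
lemma toSpace_add (x y : Site d) : toSpace (x + y) = toSpace x + toSpace y := by
  ext i; simp [toSpace]

@[simp]
lemma toSpace_sub (x y : Site d) : toSpace (x - y) = toSpace x - toSpace y := by
  ext i; simp [toSpace]

@[simp]
lemma toSpace_nsmul (n : ℕ) (x : Site d) : toSpace (n • x) = (n : ℝ) • toSpace x := by
  ext i; simp [toSpace]

/-- The class of a site modulo `σ`. -/
def siteClass (σ : ℕ) (x : Site d) : Fin d → ZMod σ := fun i => (x i : ZMod σ)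

lemma siteClass_add (σ : ℕ) (x y : Site d) :
    siteClass σ (x + y) = siteClass σ x + siteClass σ y := by
  ext i; simp [siteClass]

lemma siteClass_sub (σ : ℕ) (x y : Site d) :
    siteClass σ (x - y) = siteClass σ x - siteClass σ y := by
  ext i; simp [siteClass]

lemma siteClass_nsmul (σ n : ℕ) (x : Site d) :
    siteClass σ (n • x) = n • siteClass σ x := by
  ext i; simp [siteClass]

lemma siteClass_val {σ : ℕ} [NeZero σ] (q : Fin d → ZMod σ) :
    siteClass σ (fun i => ((q i).val : ℤ)) = q := by
  ext i; simp [siteClass]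

end Lattice

/-! ### Defect dynamics: superposition, restarting, translation, finite speed -/

namespace CA

variable (A : CA d) (η : Config d)

lemma trajectory_add (s t : ℕ) :
    A.trajectory (A.trajectory η s) t = A.trajectory η (s + t) := by
  simp only [trajectory, ← Function.iterate_add_apply, add_comm]

lemma trajectory_mul {π : ℕ} (h : A.globalMap^[π] η = η) (n : ℕ) :
    A.trajectory η (n * π) = η := by
  rw [trajectory, mul_comm, Function.iterate_mul]
  exact Function.iterate_fixed h n

lemma change_trajectory (s t : ℕ) (y x : Site d) :
    A.change (A.trajectory η s) t y x = A.change η (s + t) y x := by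
  simp only [change, trajectory_add, add_assoc]

lemma mem_defectSet_zero (D : Set (Site d)) (x : Site d) : x ∈ A.defectSet η D 0 ↔ x ∈ D := by
  by_cases h : x ∈ D <;> simp [defectSet, defectCount, h]

lemma mem_defectSet_succ (D : Set (Site d)) (t : ℕ) (x : Site d) :
    x ∈ A.defectSet η D (t + 1) ↔
      ∃ n ∈ A.nbhd, 0 < A.change η t (x + n) x ∧ x + n ∈ A.defectSet η D t := by
  simp only [defectSet, Set.mem_ofPred_eq, defectCount, Finset.sum_pos_iff,
    CanonicallyOrderedAdd.mul_pos]

/-- Counts are sums of nonnegative terms, so defects never cancel and initial defects act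
independently. -/
lemma mem_defectSet_iff (D : Set (Site d)) (t : ℕ) (x : Site d) :
    x ∈ A.defectSet η D t ↔ ∃ y ∈ D, x ∈ A.defectSet η {y} t := by
  induction t generalizing x with
  | zero => simp [mem_defectSet_zero]
  | succ t ih =>
    simp only [mem_defectSet_succ]
    constructor
    · rintro ⟨n, hn, hc, hx⟩
      obtain ⟨y, hy, hxy⟩ := (ih _).1 hx
      exact ⟨y, hy, n, hn, hc, hxy⟩
    · rintro ⟨y, hy, n, hn, hc, hxy⟩
      exact ⟨n, hn, hc, (ih _).2 ⟨y, hy, hxy⟩⟩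

lemma defectSet_add (D : Set (Site d)) (s t : ℕ) :
    A.defectSet η D (s + t) = A.defectSet (A.trajectory η s) (A.defectSet η D s) t := by
  induction t with
  | zero => ext x; simp [mem_defectSet_zero]
  | succ t ih =>
    ext x
    rw [← add_assoc, mem_defectSet_succ, mem_defectSet_succ, ih]
    simp only [change_trajectory]

lemma mem_defectSet_add (y : Site d) (s t : ℕ) (x : Site d) :
    x ∈ A.defectSet η {y} (s + t) ↔
      ∃ z ∈ A.defectSet η {y} s, x ∈ A.defectSet (A.trajectory η s) {z} t := by
  rw [defectSet_add, mem_defectSet_iff]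

/-- After whole periods the background is η again, so chains can be cut and glued at multiples of π
without changing the dynamics. -/
lemma mem_defectSet_period_add {π : ℕ} (h : A.globalMap^[π] η = η) (y : Site d) (n t : ℕ)
    (x : Site d) : x ∈ A.defectSet η {y} (n * π + t) ↔
      ∃ z ∈ A.defectSet η {y} (n * π), x ∈ A.defectSet η {z} t := by
  rw [mem_defectSet_add, trajectory_mul A η h]

section Translation

variable {η}

lemma trajectory_shift {c : Site d} (h : ∀ x, η (x + c) = η x) (t : ℕ) (x : Site d) :
    A.trajectory η t (x + c) = A.trajectory η t x := by
  induction t generalizing x with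
  | zero => exact h x
  | succ t ih =>
    simp only [trajectory, Function.iterate_succ_apply', globalMap] at ih ⊢
    congr 1
    funext n
    rw [add_right_comm]
    exact ih _

lemma perturb_shift {ξ : Config d} {c : Site d} (h : ∀ x, ξ (x + c) = ξ x) (y x : Site d) :
    perturb ξ (y + c) (x + c) = perturb ξ y x := by
  simp only [perturb, Function.update_apply, h, add_left_inj]

lemma change_shift {c : Site d} (h : ∀ x, η (x + c) = η x) (t : ℕ) (y x : Site d) :
    A.change η t (y + c) (x + c) = A.change η t y x := by
  have key : A.globalMap (perturb (A.trajectory η t) (y + c)) (x + c) =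
      A.globalMap (perturb (A.trajectory η t) y) x := by
    simp only [globalMap]
    congr 1
    funext n
    rw [add_right_comm]
    exact perturb_shift (A.trajectory_shift h t) _ _
  simp only [change, key, A.trajectory_shift h]

/-- A translation preserving η preserves its whole trajectory and the influence of every flip. This
lets pieces of chains be moved between congruent sites. -/
lemma mem_defectSet_shift {c : Site d} (h : ∀ x, η (x + c) = η x) (t : ℕ) (y x : Site d) :
    x + c ∈ A.defectSet η {y + c} t ↔ x ∈ A.defectSet η {y} t := by
  induction t generalizing x with
  | zero => simp [mem_defectSet_zero]
  | succ t ih =>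
    simp only [mem_defectSet_succ]
    refine exists_congr fun n => and_congr_right fun _ => ?_
    rw [add_right_comm, A.change_shift h, ih]

end Translation

/-- A bound on the speed at which defects spread. -/
def speed : ℝ := ∑ n ∈ A.nbhd, ‖toSpace n‖

lemma speed_nonneg : 0 ≤ A.speed := Finset.sum_nonneg fun _ _ => norm_nonneg _

lemma norm_sub_le_of_mem_defectSet {y x : Site d} {t : ℕ} (h : x ∈ A.defectSet η {y} t) :
    ‖toSpace x - toSpace y‖ ≤ A.speed * t := by
  induction t generalizing x with
  | zero =>
    rw [mem_defectSet_zero] at h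
    simp [Set.mem_singleton_iff.1 h]
  | succ t ih =>
    obtain ⟨n, hn, -, hx⟩ := (mem_defectSet_succ A η _ _ _).1 h
    have h1 := ih hx
    have h2 : ‖toSpace n‖ ≤ A.speed :=
      Finset.single_le_sum (f := fun n : Site d => ‖toSpace n‖) (fun _ _ => norm_nonneg _) hn
    have h3 : toSpace x - toSpace y = (toSpace (x + n) - toSpace y) - toSpace n := by
      rw [toSpace_add]; abel
    rw [h3]
    refine (norm_sub_le _ _).trans ?_
    push_cast
    linarith

end CA

/-! ### Irreducibility as connectivity of defect chains -/

/-- Periodicity of `η` in time (with period `π`) and space (with period `σ`), together with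
irreducibility of the associated kernel. -/
structure PeriodicIrreducible (A : CA d) (η : Config d) (π σ : ℕ) : Prop where
  time_pos : 0 < π
  space_pos : 0 < σ
  time : A.globalMap^[π] η = η
  space : ∀ x c : Site d, siteClass σ c = 0 → η (x + c) = η x
  connected : ∀ (y : Site d) (q : Fin d → ZMod σ),
    ∃ n : ℕ, 0 < n ∧ ∃ x ∈ A.defectSet η {y} (n * π), siteClass σ x = q

lemma CA.IsDoublyPeriodic.shift {A : CA d} {η : Config d} {π σ : ℕ}
    (h : A.IsDoublyPeriodic η π σ) (x c : Site d) (hc : siteClass σ c = 0) :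
    η (x + c) = η x := by
  rw [h.2.1.2 (x + c), h.2.1.2 x]
  congr 1
  funext i
  have : (σ : ℤ) ∣ c i := (ZMod.intCast_zmod_eq_zero_iff_dvd _ _).1 (congrFun hc i)
  obtain ⟨k, hk⟩ := this
  simp [hk]

lemma CA.IsDoublyPeriodic.periodicIrreducible {A : CA d} {η : Config d} {π σ : ℕ}
    (h : A.IsDoublyPeriodic η π σ) (hirr : A.IsIrreducible η π σ) :
    PeriodicIrreducible A η π σ := by
  refine ⟨h.1.1.1, h.2.1.1, h.1.1.2, h.shift, fun y q => ?_⟩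
  have : NeZero σ := ⟨(Nat.pos_of_ne_zero (Nat.one_le_iff_ne_zero.1 h.2.1.1)).ne'⟩
  let := (A.reducedKernel η π σ).toQuiver
  obtain ⟨p, hp⟩ := hirr.connected (siteClass σ y) q
  refine ⟨p.length, hp, ?_⟩
  clear hp
  induction p with
  | nil => exact ⟨y, by simp [CA.mem_defectSet_zero], rfl⟩
  | @cons b c p e ih =>
    obtain ⟨z, hz, hzb⟩ := ih
    have he : 0 < A.reducedKernel η π σ b c := e.down
    simp only [CA.reducedKernel] at he
    split_ifs at he with hx
    · obtain ⟨x, hx, hxc⟩ := hx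
      -- The kernel only tests the standard representative `r` of the class; the step is transported
      -- to the actual endpoint `z` by a translation in σℤ^d.
      set r : Site d := fun i => ((b i).val : ℤ)
      have hr : siteClass σ r = b := siteClass_val b
      have hs : siteClass σ (z - r) = 0 := by rw [siteClass_sub, hzb, hr, sub_self]
      refine ⟨x + (z - r), ?_, ?_⟩
      · rw [Quiver.Path.length_cons, Nat.succ_mul, CA.mem_defectSet_period_add A η h.1.1.2]
        refine ⟨z, hz, ?_⟩
        have := (CA.mem_defectSet_shift A (fun x => h.shift x _ hs) π r x).2 hx
        rwa [add_sub_cancel] at this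
      · rw [siteClass_add, hs, add_zero]
        exact hxc
    · exact absurd he (lt_irrefl _)

lemma finite_setOf_norm_toSpace_le (R : ℝ) : {c : Site d | ‖toSpace c‖ ≤ R}.Finite := by
  refine (Set.finite_Icc (fun _ : Fin d => -⌈R⌉) fun _ => ⌈R⌉).subset fun c hc => ?_
  have h : ∀ i, |(c i : ℝ)| ≤ ⌈R⌉ := fun i =>
    ((PiLp.norm_apply_le (toSpace c) i).trans hc).trans (Int.le_ceil R)
  refine ⟨fun i => ?_, fun i => ?_⟩
  · exact_mod_cast (abs_le.1 (h i)).1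
  · exact_mod_cast (abs_le.1 (h i)).2

/-! ### Cycles and their mean velocities -/

/-- The displacements of defect paths, of `k` temporal periods, between congruent sites. -/
def CA.cycles (A : CA d) (η : Config d) (π σ k : ℕ) : Set (Site d) :=
  {c | siteClass σ c = 0 ∧ ∃ y, y + c ∈ A.defectSet η {y} (k * π)}

/-- The mean velocities of short cycles of defects. -/
def CA.velocities (A : CA d) (η : Config d) (π σ : ℕ) : Set (EuclideanSpace ℝ (Fin d)) :=
  {v | ∃ k, 0 < k ∧ k ≤ Nat.card (Fin d → ZMod σ) ∧
    ∃ c ∈ A.cycles η π σ k, v = ((k * π : ℕ) : ℝ)⁻¹ • toSpace c}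

lemma CA.norm_le_of_mem_cycles {A : CA d} {η : Config d} {π σ k : ℕ} {c : Site d}
    (hc : c ∈ A.cycles η π σ k) : ‖toSpace c‖ ≤ A.speed * (k * π : ℕ) := by
  obtain ⟨-, y, hy⟩ := hc
  simpa using A.norm_sub_le_of_mem_defectSet η hy

lemma CA.finite_velocities (A : CA d) (η : Config d) (π σ : ℕ) :
    (A.velocities η π σ).Finite := by
  have : A.velocities η π σ ⊆ ⋃ k ∈ Set.Iic (Nat.card (Fin d → ZMod σ)),
      (fun c => ((k * π : ℕ) : ℝ)⁻¹ • toSpace c) '' A.cycles η π σ k := by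
    rintro v ⟨k, -, hk, c, hc, rfl⟩
    exact Set.mem_biUnion (Set.mem_Iic.2 hk) ⟨c, hc, rfl⟩
  refine ((Set.finite_Iic _).biUnion fun k _ => Set.Finite.image _ ?_).subset this
  exact (finite_setOf_norm_toSpace_le _).subset fun c hc => norm_le_of_mem_cycles hc

lemma CA.norm_le_of_mem_convexHull_velocities {A : CA d} {η : Config d} {π σ : ℕ}
    {v : EuclideanSpace ℝ (Fin d)} (hv : v ∈ convexHull ℝ (A.velocities η π σ)) :
    ‖v‖ ≤ A.speed := by
  have h : A.velocities η π σ ⊆ Metric.closedBall 0 A.speed := by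
    rintro v ⟨k, -, -, c, hc, rfl⟩
    rw [mem_closedBall_zero_iff, norm_smul, norm_inv, Real.norm_natCast]
    -- Positivity of π is not available here; if `k * π = 0`, the velocity is `0` because `0⁻¹ = 0`.
    rcases (Nat.cast_nonneg (α := ℝ) (k * π)).eq_or_lt with h0 | h0
    · rw [← h0]
      simpa using A.speed_nonneg
    · rw [inv_mul_le_iff₀ h0, mul_comm]
      exact norm_le_of_mem_cycles hc
  simpa using convexHull_min h (convex_closedBall _ _) hv

/-! ### Upper bound: decomposing chains into cycles -/

namespace PeriodicIrreducible

variable {A : CA d} {η : Config d} {π σ : ℕ}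

lemma exists_mem_defectSet_of_mem {y x : Site d} {n : ℕ}
    (hx : x ∈ A.defectSet η {y} (n * π)) {t : ℕ} (ht : t ≤ n * π) :
    ∃ x' ∈ A.defectSet η {y} t, ‖toSpace x' - toSpace x‖ ≤ A.speed * |(t : ℝ) - (n * π : ℕ)| := by
  obtain ⟨r, hr⟩ := Nat.exists_eq_add_of_le ht
  rw [hr] at hx
  obtain ⟨z, hz, hzx⟩ := (A.mem_defectSet_add η _ _ _ _).1 hx
  refine ⟨z, hz, ?_⟩
  rw [norm_sub_rev]
  refine (A.norm_sub_le_of_mem_defectSet _ hzx).trans_eq ?_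
  rw [hr]
  push_cast
  rw [sub_add_cancel_left, abs_neg, Nat.abs_cast]

/-- Irreducibility lets every chain be continued, so defects occur at arbitrarily late times;
cutting a late chain gives a defect at time t. -/
lemma defectSet_nonempty (h : PeriodicIrreducible A η π σ)
    (y : Site d) (t : ℕ) : (A.defectSet η {y} t).Nonempty := by
  have key : ∀ j : ℕ, ∃ n, j ≤ n ∧ (A.defectSet η {y} (n * π)).Nonempty := by
    intro j
    induction j with
    | zero => exact ⟨0, le_rfl, y, by simp [CA.mem_defectSet_zero]⟩
    | succ j ih =>
      obtain ⟨n, hn, z, hz⟩ := ih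
      obtain ⟨k, hk, x, hx, -⟩ := h.connected z 0
      refine ⟨n + k, by omega, x, ?_⟩
      rw [add_mul, CA.mem_defectSet_period_add A η h.time]
      exact ⟨z, hz, hx⟩
  obtain ⟨n, hn, z, hz⟩ := key t
  obtain ⟨x, hx, -⟩ := exists_mem_defectSet_of_mem hz
    (hn.trans (Nat.le_mul_of_pos_right n h.time_pos))
  exact ⟨x, hx⟩

/-- A path of defects can be shortened or prolonged. -/
lemma exists_mem_defectSet_near (h : PeriodicIrreducible A η π σ)
    {y x : Site d} {n : ℕ} (hx : x ∈ A.defectSet η {y} (n * π))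
    (t : ℕ) :
    ∃ x' ∈ A.defectSet η {y} t, ‖toSpace x' - toSpace x‖ ≤ A.speed * |(t : ℝ) - (n * π : ℕ)| := by
  rcases le_total t (n * π) with ht | ht
  · exact exists_mem_defectSet_of_mem hx ht
  · obtain ⟨r, hr⟩ := Nat.exists_eq_add_of_le ht
    obtain ⟨x', hx'⟩ := h.defectSet_nonempty x r
    refine ⟨x', ?_, ?_⟩
    · rw [hr, CA.mem_defectSet_period_add A η h.time]
      exact ⟨x, hx, hx'⟩
    · refine (A.norm_sub_le_of_mem_defectSet _ hx').trans_eq ?_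
      rw [hr]
      push_cast
      rw [add_sub_cancel_left, Nat.abs_cast]

lemma exists_path (h : PeriodicIrreducible A η π σ)
    {y x : Site d} {n : ℕ} (hx : x ∈ A.defectSet η {y} (n * π)) :
    ∃ f : ℕ → Site d, f 0 = y ∧ f n = x ∧
      ∀ i j, i + j ≤ n → f (i + j) ∈ A.defectSet η {f i} (j * π) := by
  suffices ∃ f : ℕ → Site d, f 0 = y ∧ f n = x ∧
      ∀ i < n, f (i + 1) ∈ A.defectSet η {f i} (1 * π) by
    obtain ⟨f, h0, hn, hf⟩ := this
    refine ⟨f, h0, hn, fun i j => ?_⟩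
    induction j with
    | zero => simp [CA.mem_defectSet_zero]
    | succ j ih =>
      intro hij
      rw [add_mul, CA.mem_defectSet_period_add A η h.time, ← add_assoc, ← one_mul π]
      exact ⟨f (i + j), by simpa using ih (by omega), by simpa using hf (i + j) (by omega)⟩
  induction n generalizing x with
  | zero =>
    rw [zero_mul, CA.mem_defectSet_zero] at hx
    exact ⟨fun _ => y, rfl, hx.symm, by simp⟩
  | succ n ih =>
    rw [add_mul, CA.mem_defectSet_period_add A η h.time] at hx
    obtain ⟨z, hz, hzx⟩ := hx
    obtain ⟨f, h0, hn, hf⟩ := ih hz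
    refine ⟨Function.update f (n + 1) x, ?_, by simp, fun i hi => ?_⟩
    · rw [Function.update_of_ne (by omega), h0]
    · rw [Function.update_of_ne (by omega : i ≠ n + 1)]
      rcases Nat.lt_succ_iff_lt_or_eq.1 hi with hi | rfl
      · rw [Function.update_of_ne (by omega)]
        exact hf i hi
      · rw [Function.update_self, hn]
        exact hzx

/-- A long path of defects contains a short cycle, which can be removed. -/
lemma exists_remove_cycle (h : PeriodicIrreducible A η π σ)
    {y x : Site d} {n : ℕ} (hx : x ∈ A.defectSet η {y} (n * π))
    (hn : Nat.card (Fin d → ZMod σ) ≤ n) :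
    ∃ k, 0 < k ∧ k ≤ Nat.card (Fin d → ZMod σ) ∧ ∃ c ∈ A.cycles η π σ k,
      x - c ∈ A.defectSet η {y} ((n - k) * π) := by
  have : NeZero σ := ⟨h.space_pos.ne'⟩
  obtain ⟨f, h0, hfn, hf⟩ := h.exists_path hx
  -- Pigeonhole on only the first σ^d + 1 sampled sites, which also bounds the length of the cycle.
  obtain ⟨i, j, hij, hjm, hc⟩ : ∃ i j : ℕ, i < j ∧ j ≤ Nat.card (Fin d → ZMod σ) ∧
      siteClass σ (f i) = siteClass σ (f j) := by
    rw [Nat.card_eq_fintype_card]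
    obtain ⟨i, j, hne, he⟩ := Fintype.exists_ne_map_eq_of_card_lt
      (fun i : Fin (Fintype.card (Fin d → ZMod σ) + 1) => siteClass σ (f i)) (by simp)
    rcases lt_or_gt_of_ne hne with hlt | hlt
    · exact ⟨i, j, hlt, Nat.lt_succ_iff.1 j.2, he⟩
    · exact ⟨j, i, hlt, Nat.lt_succ_iff.1 i.2, he.symm⟩
  have hs : siteClass σ (f j - f i) = 0 := by rw [siteClass_sub, hc, sub_self]
  obtain ⟨k, rfl⟩ := Nat.exists_eq_add_of_lt hij
  obtain ⟨l, rfl⟩ := Nat.exists_eq_add_of_le (hjm.trans hn)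
  refine ⟨k + 1, by omega, by omega, _, ⟨hs, f i, ?_⟩, ?_⟩
  · rw [add_sub_cancel]
    exact hf i (k + 1) (by omega)
  · rw [show i + k + 1 + l - (k + 1) = i + l by omega, add_mul,
      CA.mem_defectSet_period_add A η h.time]
    refine ⟨f i, ?_, ?_⟩
    · have := hf 0 i (by omega)
      rwa [h0, zero_add] at this
    -- With the cycle removed, the tail of the chain starts at `f i` instead of the congruent site
    -- `f j`, hence is translated.
    · rw [← CA.mem_defectSet_shift A (fun x => h.space x _ hs)]
      rw [sub_add_cancel, add_sub_cancel, ← hfn]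
      exact hf _ l le_rfl

lemma velocities_nonempty (h : PeriodicIrreducible A η π σ) : (A.velocities η π σ).Nonempty := by
  obtain ⟨x, hx⟩ := h.defectSet_nonempty 0 (Nat.card (Fin d → ZMod σ) * π)
  obtain ⟨k, hk, hkm, c, hc, -⟩ := h.exists_remove_cycle hx le_rfl
  exact ⟨_, k, hk, hkm, c, hc, rfl⟩

/-- Cycles are removed until at most σ^d periods remain: `r` counts the periods spent in cycles, `k`
is their time-weighted mean velocity, and the remainder moves a bounded distance. -/
lemma exists_velocity_period_approx (h : PeriodicIrreducible A η π σ) (n : ℕ) (y x : Site d)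
    (hx : x ∈ A.defectSet η {y} (n * π)) :
    ∃ r ≤ n, n ≤ r + Nat.card (Fin d → ZMod σ) ∧ ∃ k ∈ convexHull ℝ (A.velocities η π σ),
      ‖toSpace x - toSpace y - ((r * π : ℕ) : ℝ) • k‖ ≤
        A.speed * (Nat.card (Fin d → ZMod σ) * π : ℕ) := by
  induction n using Nat.strong_induction_on generalizing x with
  | _ n ih =>
    rcases le_total (Nat.card (Fin d → ZMod σ)) n with hn | hn
    · obtain ⟨m, hm, hmc, c, hc, hxc⟩ := h.exists_remove_cycle hx hn
      obtain ⟨r, hr, hrn, k, hk, hle⟩ := ih (n - m) (by omega) _ hxc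
      refine ⟨r + m, by omega, by omega, ?_⟩
      have hmπ : (0 : ℝ) < (m * π : ℕ) := by exact_mod_cast Nat.mul_pos hm h.time_pos
      have hv : ((m * π : ℕ) : ℝ)⁻¹ • toSpace c ∈ convexHull ℝ (A.velocities η π σ) :=
        subset_convexHull ℝ _ ⟨m, hm, hmc, c, hc, rfl⟩
      -- For convex K and a, b ≥ 0 one has (a + b)K = aK + bK, so adding a cycle keeps the
      -- displacement in a dilate of the hull.
      have hadd := (convex_convexHull ℝ (A.velocities η π σ)).add_smul
        (Nat.cast_nonneg (α := ℝ) (r * π)) hmπ.le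
      have hmem := Set.add_mem_add (Set.smul_mem_smul_set (a := ((r * π : ℕ) : ℝ)) hk)
        (Set.smul_mem_smul_set (a := ((m * π : ℕ) : ℝ)) hv)
      rw [← hadd] at hmem
      obtain ⟨k', hk', he⟩ := hmem
      refine ⟨k', hk', ?_⟩
      simp only [smul_inv_smul₀ hmπ.ne'] at he
      rw [add_mul, Nat.cast_add, he]
      convert hle using 2
      rw [toSpace_sub]
      abel
    · obtain ⟨v, hv⟩ := h.velocities_nonempty
      refine ⟨0, by omega, by omega, v, subset_convexHull ℝ _ hv, ?_⟩
      simp only [zero_mul, Nat.cast_zero, zero_smul, sub_zero]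
      refine (A.norm_sub_le_of_mem_defectSet _ hx).trans ?_
      have := A.speed_nonneg
      gcongr

/-- Defects spread with mean velocities in the convex hull of the velocities of cycles. -/
lemma exists_velocity_approx (h : PeriodicIrreducible A η π σ) :
    ∃ C : ℝ, ∀ (t : ℕ) (y x : Site d), x ∈ A.defectSet η {y} t →
      ∃ k ∈ convexHull ℝ (A.velocities η π σ),
        ‖toSpace x - toSpace y - (t : ℝ) • k‖ ≤ C := by
  set m := Nat.card (Fin d → ZMod σ)
  -- The three terms pay for the final incomplete period, the acyclic remainder, and replacing the
  -- cycle time r π by t.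
  refine ⟨A.speed * π + A.speed * (m * π : ℕ) + (m + 1) * π * A.speed, fun t y x hx => ?_⟩
  have ht : t = t / π * π + t % π := by rw [mul_comm]; exact (Nat.div_add_mod t π).symm
  have hmod : t % π < π := Nat.mod_lt _ h.time_pos
  set n := t / π
  set l := t % π
  rw [ht, CA.mem_defectSet_period_add A η h.time] at hx
  obtain ⟨z, hz, hzx⟩ := hx
  obtain ⟨r, hr, hrn, k, hk, hle⟩ := h.exists_velocity_period_approx n y z hz
  refine ⟨k, hk, ?_⟩
  have e : toSpace x - toSpace y - (t : ℝ) • k = (toSpace x - toSpace z) +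
      (toSpace z - toSpace y - ((r * π : ℕ) : ℝ) • k) - ((t : ℝ) - (r * π : ℕ)) • k := by
    module
  have h0 := A.speed_nonneg
  have h1 : ‖toSpace x - toSpace z‖ ≤ A.speed * π :=
    (A.norm_sub_le_of_mem_defectSet _ hzx).trans (by gcongr)
  have h2 : ‖((t : ℝ) - (r * π : ℕ)) • k‖ ≤ (m + 1) * π * A.speed := by
    rw [norm_smul]
    have h3 : (r * π : ℕ) ≤ t := by rw [ht]; nlinarith
    have h4 : t ≤ r * π + (m + 1) * π := by
      rw [ht]
      nlinarith
    have h5 : ‖(t : ℝ) - (r * π : ℕ)‖ ≤ (m + 1) * π := by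
      rw [Real.norm_of_nonneg (sub_nonneg.2 (by exact_mod_cast h3))]
      have : (t : ℝ) ≤ (r * π : ℕ) + (m + 1) * π := by exact_mod_cast h4
      linarith
    have h6 := CA.norm_le_of_mem_convexHull_velocities hk
    gcongr
  rw [e]
  exact (norm_sub_le _ _).trans (add_le_add ((norm_add_le _ _).trans (add_le_add h1 hle)) h2)

end PeriodicIrreducible

/-! ### Lower bound: attaining every velocity -/

/-- Up to the error `C`, defects can spread with any velocity in `K`. -/
def CA.Attains (A : CA d) (η : Config d) (C : ℝ) (K : Set (EuclideanSpace ℝ (Fin d))) : Prop :=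
  ∀ k ∈ K, ∀ (t : ℕ) (y : Site d), ∃ x ∈ A.defectSet η {y} t,
    ‖toSpace x - toSpace y - (t : ℝ) • k‖ ≤ C

namespace PeriodicIrreducible

variable {A : CA d} {η : Config d} {π σ : ℕ}

/-- By translation only the classes of the endpoints matter, and there are finitely many pairs of
them. -/
lemma exists_uniform_connection (h : PeriodicIrreducible A η π σ) :
    ∃ N : ℕ, ∀ (y : Site d) (q : Fin d → ZMod σ),
    ∃ n ≤ N, ∃ x ∈ A.defectSet η {y} (n * π), siteClass σ x = q := by
  have : NeZero σ := ⟨h.space_pos.ne'⟩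
  choose n hn x hx hxq using fun p q : Fin d → ZMod σ =>
    h.connected (fun i => ((p i).val : ℤ)) q
  obtain ⟨N, hN⟩ := (Set.finite_range fun p : (Fin d → ZMod σ) × (Fin d → ZMod σ) =>
    n p.1 p.2).bddAbove
  refine ⟨N, fun y q => ⟨n (siteClass σ y) q, hN ⟨(siteClass σ y, q), rfl⟩, ?_⟩⟩
  set r : Site d := fun i => ((siteClass σ y i).val : ℤ)
  have hs : siteClass σ (y - r) = 0 := by
    rw [siteClass_sub, sub_eq_zero]
    exact (siteClass_val (siteClass σ y)).symm
  refine ⟨x (siteClass σ y) q + (y - r), ?_, ?_⟩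
  · have := (CA.mem_defectSet_shift A (fun x => h.space x _ hs) _ r _).2 (hx (siteClass σ y) q)
    rwa [add_sub_cancel] at this
  · rw [siteClass_add, hs, hxq, add_zero]

lemma nsmul_cycle_mem (h : PeriodicIrreducible A η π σ)
    {k : ℕ} {y c : Site d} (hc : siteClass σ c = 0)
    (hy : y + c ∈ A.defectSet η {y} (k * π)) (j : ℕ) :
    y + j • c ∈ A.defectSet η {y} (j * k * π) := by
  induction j with
  | zero => simp [CA.mem_defectSet_zero]
  | succ j ih =>
    rw [add_mul, one_mul, add_mul, CA.mem_defectSet_period_add A η h.time]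
    refine ⟨_, ih, ?_⟩
    have hs : siteClass σ (j • c) = 0 := by rw [siteClass_nsmul, hc, smul_zero]
    have := (CA.mem_defectSet_shift A (fun x => h.space x _ hs) _ _ _).2 hy
    rwa [add_nsmul, one_nsmul, add_comm (j • c), ← add_assoc]

/-- From `y`, reach a translate of the start of the cycle within N periods, then repeat the cycle ⌊t
/ (kπ)⌋ times. -/
lemma exists_attains_singleton (h : PeriodicIrreducible A η π σ)
    {v : EuclideanSpace ℝ (Fin d)} (hv : v ∈ A.velocities η π σ) :
    ∃ C, A.Attains η C {v} := by
  obtain ⟨k, hk, -, c, ⟨hc, y₀, hy₀⟩, rfl⟩ := hv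
  obtain ⟨N, hN⟩ := h.exists_uniform_connection
  have hkπ : 0 < k * π := Nat.mul_pos hk h.time_pos
  -- In order: adjusting the length of the chain to t, the initial connection, and rounding the
  -- number of cycles.
  refine ⟨A.speed * (N * π + k * π : ℕ) + A.speed * (N * π : ℕ) + ‖toSpace c‖, ?_⟩
  intro v hv t y
  rw [Set.mem_singleton_iff.1 hv]
  obtain ⟨n, hn, z, hz, hzq⟩ := hN y (siteClass σ y₀)
  have hs : siteClass σ (z - y₀) = 0 := by rw [siteClass_sub, hzq, sub_self]
  have hzc : z + c ∈ A.defectSet η {z} (k * π) := by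
    have := (CA.mem_defectSet_shift A (fun x => h.space x _ hs) _ _ _).2 hy₀
    rwa [add_right_comm, add_sub_cancel] at this
  set j := t / (k * π)
  have hzj := h.nsmul_cycle_mem hc hzc j
  have hyz : z + j • c ∈ A.defectSet η {y} ((n + j * k) * π) := by
    rw [add_mul, CA.mem_defectSet_period_add A η h.time]
    exact ⟨z, hz, hzj⟩
  obtain ⟨x, hx, hxz⟩ := h.exists_mem_defectSet_near hyz t
  refine ⟨x, hx, ?_⟩
  have hjle : j * (k * π) ≤ t := Nat.div_mul_le_self t (k * π)
  have hjlt : t < j * (k * π) + k * π := by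
    have := Nat.lt_div_mul_add (a := t) hkπ
    exact this
  have h0 := A.speed_nonneg
  have h1 : ‖toSpace x - toSpace (z + j • c)‖ ≤ A.speed * (N * π + k * π : ℕ) := by
    refine hxz.trans (mul_le_mul_of_nonneg_left ?_ h0)
    have hnN : n * π ≤ N * π := Nat.mul_le_mul_right _ hn
    have e1 : ((n + j * k) * π : ℕ) = n * π + j * (k * π) := by ring
    rw [e1, abs_le]
    constructor
    · have : n * π + j * (k * π) ≤ t + (N * π + k * π) := by omega
      have : ((n * π + j * (k * π) : ℕ) : ℝ) ≤ t + (N * π + k * π : ℕ) := by exact_mod_cast this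
      linarith
    · have : t ≤ N * π + k * π + (n * π + j * (k * π)) := by omega
      have : (t : ℝ) ≤ (N * π + k * π : ℕ) + (n * π + j * (k * π) : ℕ) := by exact_mod_cast this
      linarith
  have h2 : ‖toSpace z - toSpace y‖ ≤ A.speed * (N * π : ℕ) :=
    (A.norm_sub_le_of_mem_defectSet _ hz).trans (by gcongr)
  have hkR : (0 : ℝ) < (k * π : ℕ) := by exact_mod_cast hkπ
  have h3 : ‖((j : ℝ) - t * ((k * π : ℕ) : ℝ)⁻¹) • toSpace c‖ ≤ ‖toSpace c‖ := by
    rw [norm_smul]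
    refine mul_le_of_le_one_left (norm_nonneg _) ?_
    rw [Real.norm_eq_abs, ← div_eq_mul_inv, abs_sub_comm, abs_le]
    have a1 : (j : ℝ) ≤ t / (k * π : ℕ) := by
      rw [le_div_iff₀ hkR]; exact_mod_cast hjle
    have a2 : (t : ℝ) / (k * π : ℕ) ≤ j + 1 := by
      rw [div_le_iff₀ hkR, add_mul, one_mul]; exact_mod_cast hjlt.le
    constructor <;> linarith
  have e : toSpace x - toSpace y - (t : ℝ) • ((k * π : ℕ) : ℝ)⁻¹ • toSpace c =
      (toSpace x - toSpace (z + j • c)) + (toSpace z - toSpace y) +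
        ((j : ℝ) - t * ((k * π : ℕ) : ℝ)⁻¹) • toSpace c := by
    rw [toSpace_add, toSpace_nsmul]
    module
  rw [e]
  exact (norm_add_le _ _).trans (add_le_add ((norm_add_le _ _).trans (add_le_add h1 h2)) h3)

/-- Velocity α k₁ + β k₂ results from following k₁ for a fraction α of the time and k₂ afterwards.
-/
lemma attains_convexJoin (h : PeriodicIrreducible A η π σ)
    {C₁ C₂ R : ℝ} {K₁ K₂ : Set (EuclideanSpace ℝ (Fin d))}
    (h₁ : A.Attains η C₁ K₁) (h₂ : A.Attains η C₂ K₂)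
    (hR₁ : ∀ k ∈ K₁, ‖k‖ ≤ R) (hR₂ : ∀ k ∈ K₂, ‖k‖ ≤ R) :
    A.Attains η (C₁ + C₂ + π * (R + R)) (convexJoin ℝ K₁ K₂) := by
  intro k hk t y
  obtain ⟨k₁, hk₁, k₂, hk₂, α, β, hα, hβ, hαβ, rfl⟩ := mem_convexJoin.1 hk
  have hπ : (0 : ℝ) < π := by exact_mod_cast h.time_pos
  -- The switch must occur at a multiple of π, where the background is η again; rounding costs at
  -- most π‖k₂ - k₁‖.
  set n := ⌊α * t / π⌋₊
  have hn1 : (n : ℝ) * π ≤ α * t := by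
    rw [← le_div_iff₀ hπ]
    exact Nat.floor_le (by positivity)
  have hn2 : α * t ≤ n * π + π := by
    have := (Nat.lt_floor_add_one (α * t / π)).le
    rw [div_le_iff₀ hπ] at this
    linarith
  have hnt : n * π ≤ t := by
    have : (n : ℝ) * π ≤ t := hn1.trans (mul_le_of_le_one_left (Nat.cast_nonneg t) (by linarith))
    exact_mod_cast this
  obtain ⟨s, hs⟩ := Nat.exists_eq_add_of_le hnt
  obtain ⟨z, hz, hzn⟩ := h₁ k₁ hk₁ (n * π) y
  obtain ⟨x, hx, hxn⟩ := h₂ k₂ hk₂ s z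
  refine ⟨x, ?_, ?_⟩
  · rw [hs, CA.mem_defectSet_period_add A η h.time]
    exact ⟨z, hz, hx⟩
  · have hsR : (s : ℝ) = t - n * π := by rw [hs]; push_cast; ring
    have e : toSpace x - toSpace y - (t : ℝ) • (α • k₁ + β • k₂) =
        (toSpace z - toSpace y - ((n * π : ℕ) : ℝ) • k₁) + (toSpace x - toSpace z - (s : ℝ) • k₂)
          + (α * t - n * π) • (k₂ - k₁) := by
      rw [hsR, ← sub_eq_iff_eq_add'.2 hαβ.symm]
      push_cast
      module
    have h3 : ‖(α * t - n * π) • (k₂ - k₁)‖ ≤ π * (R + R) := by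
      rw [norm_smul, Real.norm_of_nonneg (by linarith)]
      have : ‖k₂ - k₁‖ ≤ R + R := (norm_sub_le _ _).trans (add_le_add (hR₂ _ hk₂) (hR₁ _ hk₁))
      exact mul_le_mul (by linarith) this (norm_nonneg _) hπ.le
    rw [e]
    exact (norm_add_le _ _).trans (add_le_add ((norm_add_le _ _).trans (add_le_add hzn hxn)) h3)

/-- Every velocity in the convex hull of the velocities of cycles is attained. -/
lemma exists_attains (h : PeriodicIrreducible A η π σ) :
    ∃ C, A.Attains η C (convexHull ℝ (A.velocities η π σ)) := by
  have key : ∀ T : Set (EuclideanSpace ℝ (Fin d)), T.Finite → T ⊆ A.velocities η π σ →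
      ∃ C, A.Attains η C (convexHull ℝ T) := by
    intro T hT
    induction T, hT using Set.Finite.induction_on with
    | empty => exact fun _ => ⟨0, by simp [CA.Attains]⟩
    | @insert v T hv hT ih =>
      intro hsub
      obtain ⟨hvV, hTV⟩ := Set.insert_subset_iff.1 hsub
      obtain ⟨C₁, h₁⟩ := h.exists_attains_singleton hvV
      rcases T.eq_empty_or_nonempty with rfl | hne
      · exact ⟨C₁, by simpa using h₁⟩
      · obtain ⟨C₂, h₂⟩ := ih hTV
        refine ⟨C₁ + C₂ + π * (A.speed + A.speed), ?_⟩
        rw [convexHull_insert hne]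
        refine h.attains_convexJoin h₁ h₂ (R := A.speed) ?_ ?_
        · intro k hk
          rw [Set.mem_singleton_iff.1 hk]
          exact CA.norm_le_of_mem_convexHull_velocities (subset_convexHull ℝ _ hvV)
        · exact fun k hk => CA.norm_le_of_mem_convexHull_velocities (convexHull_mono hTV hk)
  exact key _ (A.finite_velocities η π σ) subset_rfl

end PeriodicIrreducible

/-! ### Polyhedra, extreme points and support functions -/

section ConvexGeometry

variable {E : Type*} [NormedAddCommGroup E] [InnerProductSpace ℝ E]

/-- A compact convex set with finitely many extreme points is the convex hull of a finite set. -/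
lemma exists_finset_convexHull_of_finite_extremePoints {K : Set E}
    (hK : IsCompact K) (hc : Convex ℝ K) (hf : (K.extremePoints ℝ).Finite) :
    ∃ V : Finset E, K = convexHull ℝ (V : Set E) := by
  refine ⟨hf.toFinset, ?_⟩
  rw [hf.coe_toFinset, ← (hf.isClosed_convexHull ℝ).closure_eq,
    closure_convexHull_extremePoints hK hc]

/-- In a bounded polyhedron, an extreme point is determined by the constraints active at it. -/
lemma eq_of_active_constraints_eq (V : Finset E) {x y : E}
    (hx : x ∈ ({z | ∀ k ∈ V, inner ℝ z k ≤ 1} : Set E).extremePoints ℝ)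
    (h : ∀ k ∈ V, inner ℝ x k = 1 → inner ℝ y k = 1) : x = y := by
  -- Moving `x` along ±(x - y) leaves its active constraints unchanged, and the finitely many others
  -- have slack; so x is the midpoint of a segment in the polyhedron, degenerate by extremality.
  obtain ⟨ε, hε, hεV⟩ : ∃ ε : ℝ, 0 < ε ∧ ∀ k ∈ V, inner ℝ x k + ε * |inner ℝ (x - y) k| ≤ 1 := by
    have : ∀ k ∈ V, ∀ᶠ ε : ℝ in 𝓝[>] 0, inner ℝ x k + ε * |inner ℝ (x - y) k| ≤ 1 := by
      intro k hk
      rcases (hx.1 k hk).eq_or_lt with he | hlt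
      · refine Eventually.of_forall fun ε => ?_
        simp [inner_sub_left, he, h k hk he]
      · have hcont : Continuous fun ε : ℝ => inner ℝ x k + ε * |inner ℝ (x - y) k| := by fun_prop
        have := hcont.tendsto 0
        simp only [zero_mul, add_zero] at this
        exact ((this.eventually_lt_const hlt).filter_mono nhdsWithin_le_nhds).mono
          fun ε h => h.le
    have h1 := (Finset.eventually_all V).2 this
    obtain ⟨ε, h2, h3⟩ := (h1.and self_mem_nhdsWithin).exists
    exact ⟨ε, h3, h2⟩
  have hp : x + ε • (x - y) ∈ {z | ∀ k ∈ V, inner ℝ z k ≤ 1} := by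
    intro k hk
    rw [inner_add_left, real_inner_smul_left]
    nlinarith [hεV k hk, le_abs_self (inner ℝ (x - y) k)]
  have hm : x - ε • (x - y) ∈ {z | ∀ k ∈ V, inner ℝ z k ≤ 1} := by
    intro k hk
    rw [inner_sub_left, real_inner_smul_left]
    nlinarith [hεV k hk, neg_abs_le (inner ℝ (x - y) k)]
  have hs : x ∈ openSegment ℝ (x + ε • (x - y)) (x - ε • (x - y)) := by
    refine ⟨1 / 2, 1 / 2, by norm_num, by norm_num, by norm_num, ?_⟩
    module
  have := hx.2 hp hm hs
  have h0 : ε • (x - y) = 0 := by simpa using this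
  exact sub_eq_zero.1 ((smul_eq_zero.1 h0).resolve_left hε.ne')

/-- The set of active constraints is an injective label on extreme points, with values among the
subsets of `V`. -/
lemma finite_extremePoints_polyhedron (V : Finset E) :
    (({z | ∀ k ∈ V, inner ℝ z k ≤ 1} : Set E).extremePoints ℝ).Finite := by
  classical
  refine Set.Finite.of_finite_image (f := fun x => V.filter fun k => inner ℝ x k = 1)
    (V.powerset.finite_toSet.subset ?_) ?_
  · rintro _ ⟨x, -, rfl⟩
    exact Finset.mem_powerset.2 (Finset.filter_subset _ _)
  · intro x hx y _ hxy
    refine eq_of_active_constraints_eq V hx fun k hk hk1 => ?_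
    have : k ∈ V.filter fun k => inner ℝ x k = 1 := Finset.mem_filter.2 ⟨hk, hk1⟩
    simp only at hxy
    rw [hxy] at this
    exact (Finset.mem_filter.1 this).2

lemma isClosed_polyhedron (V : Finset E) :
    IsClosed {z : E | ∀ k ∈ V, inner ℝ z k ≤ 1} := by
  simp only [Set.ofPred_forall]
  exact isClosed_biInter fun k _ => isClosed_le (by fun_prop) continuous_const

lemma convex_polyhedron (V : Finset E) :
    Convex ℝ {z : E | ∀ k ∈ V, inner ℝ z k ≤ 1} := by
  intro x hx y hy a b ha hb hab k hk
  rw [inner_add_left, real_inner_smul_left, real_inner_smul_left]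
  nlinarith [hx k hk, hy k hk]

/-- A bounded polyhedron is the convex hull of a finite set. -/
lemma exists_finset_convexHull_polyhedron [FiniteDimensional ℝ E] (V : Finset E)
    (hb : Bornology.IsBounded {z : E | ∀ k ∈ V, inner ℝ z k ≤ 1}) :
    ∃ W : Finset E, {z : E | ∀ k ∈ V, inner ℝ z k ≤ 1} = convexHull ℝ (W : Set E) :=
  exists_finset_convexHull_of_finite_extremePoints
    (Metric.isCompact_of_isClosed_isBounded (isClosed_polyhedron V) hb) (convex_polyhedron V)
    (finite_extremePoints_polyhedron V)

lemma zero_mem_interior_polyhedron (V : Finset E) :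
    (0 : E) ∈ interior {z : E | ∀ k ∈ V, inner ℝ z k ≤ 1} := by
  rw [mem_interior_iff_mem_nhds]
  have : ∀ k ∈ V, ∀ᶠ z : E in 𝓝 0, inner ℝ z k ≤ 1 := by
    intro k _
    have hcont : Continuous fun z : E => inner ℝ z k := by fun_prop
    have := hcont.tendsto 0
    rw [inner_zero_left] at this
    exact (this.eventually_lt_const one_pos).mono fun _ h => h.le
  exact (Finset.eventually_all V).2 this

/-- The support function of a nonempty finite set. -/
def supportFun (V : Finset E) (hV : V.Nonempty) (u : E) : ℝ :=
  V.sup' hV fun k => inner ℝ k u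

variable {V : Finset E} {hV : V.Nonempty}

lemma inner_le_supportFun {k : E} (hk : k ∈ convexHull ℝ (V : Set E)) (u : E) :
    inner ℝ k u ≤ supportFun V hV u := by
  refine convexHull_min (t := {k | inner ℝ k u ≤ supportFun V hV u}) (fun k hk => ?_) ?_ hk
  · exact Finset.le_sup' (fun k => inner ℝ k u) hk
  · intro x hx y hy a b ha hb hab
    simp only [Set.mem_ofPred_eq] at *
    rw [inner_add_left, real_inner_smul_left, real_inner_smul_left]
    calc _ ≤ a * supportFun V hV u + b * supportFun V hV u := by gcongr
      _ = _ := by rw [← add_mul, hab, one_mul]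

lemma exists_inner_eq_supportFun (hV : V.Nonempty) (u : E) :
    ∃ k ∈ V, inner ℝ k u = supportFun V hV u := by
  obtain ⟨k, hk, h⟩ := Finset.exists_mem_eq_sup' hV fun k : E => inner ℝ k u
  exact ⟨k, hk, h.symm⟩

lemma continuous_supportFun : Continuous (supportFun V hV) :=
  Continuous.finset_sup'_apply hV fun k _ => by fun_prop

/-- A polytope is the intersection of its supporting half-spaces. -/
lemma mem_convexHull_iff_inner_le [CompleteSpace E] {x : E} :
    x ∈ convexHull ℝ (V : Set E) ↔
      ∀ u ∈ Metric.sphere (0 : E) 1, inner ℝ x u ≤ supportFun V hV u := by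
  refine ⟨fun h u _ => inner_le_supportFun h u, fun h => ?_⟩
  by_contra hx
  obtain ⟨f, c, hfc, hcx⟩ := geometric_hahn_banach_closed_point (convex_convexHull ℝ (V : Set E))
    (V.finite_toSet.isClosed_convexHull ℝ) hx
  obtain ⟨v, rfl⟩ := (InnerProductSpace.toDual ℝ E).surjective f
  simp only [InnerProductSpace.toDual_apply_apply] at hfc hcx
  have hv : v ≠ 0 := by
    rintro rfl
    obtain ⟨k, hk⟩ := hV
    have := hfc k (subset_convexHull ℝ _ hk)
    simp only [inner_zero_left] at this hcx
    linarith
  have hn : 0 < ‖v‖ := norm_pos_iff.2 hv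
  have h1 := h (‖v‖⁻¹ • v) (by simp [norm_smul, hn.ne'])
  obtain ⟨k, hk, hk2⟩ := exists_inner_eq_supportFun hV (‖v‖⁻¹ • v)
  have h3 := hfc k (subset_convexHull ℝ _ hk)
  rw [← hk2, real_inner_smul_right, real_inner_smul_right, real_inner_comm, real_inner_comm v k]
    at h1
  have := le_of_mul_le_mul_left h1 (inv_pos.2 hn)
  linarith

end ConvexGeometry

/-! ### The Frank diagram and its polar -/

section Frank

variable {w : Dir d → ℝ}

lemma polarTransform_frankDiagram (hw : ∀ u, 0 < w u) :
    polarTransform (frankDiagram w) =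
      {x | ∀ u : Dir d, inner ℝ x (u : EuclideanSpace ℝ (Fin d)) ≤ w u} := by
  ext x
  constructor
  · intro h u
    have := h ((w u)⁻¹ • (u : EuclideanSpace ℝ (Fin d))) (Set.mem_iUnion.2
      ⟨u, (w u)⁻¹, (inv_pos.2 (hw u)).le, (inv_mul_cancel₀ (hw u).ne').le, rfl⟩)
    rw [real_inner_smul_right, inv_mul_le_iff₀ (hw u), mul_one] at this
    exact this
  · intro h y hy
    obtain ⟨u, α, hα, hαw, rfl⟩ := Set.mem_iUnion.1 hy
    rw [real_inner_smul_right]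
    exact (mul_le_mul_of_nonneg_left (h u) hα).trans hαw

variable {V : Finset (EuclideanSpace ℝ (Fin d))} {hV : V.Nonempty}

/-- On the ray of u, the bound α w(u) ≤ 1 on the maximum is the conjunction of the bounds ⟨α u, k⟩ ≤
1. -/
lemma frankDiagram_supportFun (hd : 1 ≤ d) :
    frankDiagram (fun u : Dir d => supportFun V hV u) = {y | ∀ k ∈ V, inner ℝ y k ≤ 1} := by
  have key : ∀ (u : EuclideanSpace ℝ (Fin d)) (α : ℝ), 0 ≤ α →
      (α * supportFun V hV u ≤ 1 ↔ ∀ k ∈ V, inner ℝ (α • u) k ≤ 1) := by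
    intro u α hα
    constructor
    · intro h k hk
      rw [real_inner_smul_left, real_inner_comm]
      exact (mul_le_mul_of_nonneg_left
        (inner_le_supportFun (hV := hV) (subset_convexHull ℝ _ hk) u) hα).trans h
    · intro h
      obtain ⟨k, hk, hk2⟩ := exists_inner_eq_supportFun hV u
      have := h k hk
      rwa [real_inner_smul_left, real_inner_comm, hk2] at this
  ext y
  constructor
  · intro hy
    obtain ⟨u, α, hα, hαw, rfl⟩ := Set.mem_iUnion.1 hy
    exact (key u α hα).1 hαw
  · intro hy
    obtain ⟨u, α, hα, rfl⟩ : ∃ (u : Dir d) (α : ℝ), 0 ≤ α ∧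
        y = α • (u : EuclideanSpace ℝ (Fin d)) := by
      by_cases h0 : y = 0
      · exact ⟨⟨EuclideanSpace.single ⟨0, hd⟩ 1, by simp⟩, 0, le_rfl, by simp [h0]⟩
      · have hn : ‖y‖ ≠ 0 := norm_ne_zero_iff.2 h0
        refine ⟨⟨‖y‖⁻¹ • y, by simp [norm_smul, hn]⟩, ‖y‖, norm_nonneg _, ?_⟩
        simp [smul_smul, hn]
    exact Set.mem_iUnion.2 ⟨u, α, hα, (key u α hα).2 hy, rfl⟩

/-- The diagram is a polyhedron; it is bounded because w attains a positive minimum on the compact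
sphere. -/
lemma isConvexPolytope_frankDiagram (hd : 1 ≤ d) (hw : ∀ u : Dir d, 0 < supportFun V hV u) :
    IsConvexPolytope (frankDiagram fun u : Dir d => supportFun V hV u) := by
  have hb : Bornology.IsBounded (frankDiagram fun u : Dir d => supportFun V hV u) := by
    have : Nonempty (Dir d) := ⟨⟨EuclideanSpace.single ⟨0, hd⟩ 1, by simp⟩⟩
    obtain ⟨u₀, -, hu₀⟩ := (isCompact_univ (X := Dir d)).exists_isMinOn Set.univ_nonempty
      ((continuous_supportFun (V := V) (hV := hV)).comp continuous_subtype_val).continuousOn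
    refine isBounded_iff_forall_norm_le.2 ⟨(supportFun V hV u₀)⁻¹, fun y hy => ?_⟩
    obtain ⟨u, α, hα, hαw, rfl⟩ := Set.mem_iUnion.1 hy
    have h1 : supportFun V hV u₀ ≤ supportFun V hV u := hu₀ (Set.mem_univ u)
    have h2 : ‖(u : EuclideanSpace ℝ (Fin d))‖ = 1 := by simp
    rw [norm_smul, h2, mul_one, Real.norm_of_nonneg hα, ← one_div, le_div_iff₀ (hw u₀)]
    exact (mul_le_mul_of_nonneg_left h1 hα).trans hαw
  rw [frankDiagram_supportFun hd] at hb ⊢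
  exact ⟨exists_finset_convexHull_polyhedron V hb, 0, zero_mem_interior_polyhedron V⟩

end Frank

/-! ### Passing to the moving frame -/

section Moving

open scoped Pointwise

variable {A : CA d} {η : Config d} {π σ : ℕ}

lemma CA.mem_movingDefectSet_iff (A : CA d) (η : Config d) (a : Site d) (D : Set (Site d)) (t : ℕ)
    (x : Site d) :
    x ∈ A.movingDefectSet η a D t ↔ ∃ y ∈ D, x ∈ A.movingDefectSet η a {y} t :=
  A.mem_defectSet_iff η D t (x + t • a)

/-- The mean velocities of short cycles of defects, relative to the frame moving by `a`. -/
def CA.relVelocities (A : CA d) (η : Config d) (π σ : ℕ) (a : Site d) :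
    Finset (EuclideanSpace ℝ (Fin d)) :=
  ((A.finite_velocities η π σ).vadd_set (a := -toSpace a)).toFinset

lemma CA.convexHull_relVelocities (A : CA d) (η : Config d) (π σ : ℕ) (a : Site d) :
    convexHull ℝ (A.relVelocities η π σ a : Set (EuclideanSpace ℝ (Fin d))) =
      -toSpace a +ᵥ convexHull ℝ (A.velocities η π σ) := by
  rw [relVelocities, Set.Finite.coe_toFinset, convexHull_vadd]

namespace PeriodicIrreducible

lemma relVelocities_nonempty (h : PeriodicIrreducible A η π σ) (a : Site d) :
    (A.relVelocities η π σ a).Nonempty := by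
  rw [CA.relVelocities, Set.Finite.toFinset_nonempty]
  exact h.velocities_nonempty.vadd_set

lemma exists_relVelocity_approx (h : PeriodicIrreducible A η π σ) (a : Site d) :
    ∃ C : ℝ, ∀ (t : ℕ) (y x : Site d), x ∈ A.movingDefectSet η a {y} t →
      ∃ k ∈ convexHull ℝ (A.relVelocities η π σ a : Set (EuclideanSpace ℝ (Fin d))),
        ‖toSpace x - toSpace y - (t : ℝ) • k‖ ≤ C := by
  obtain ⟨C, hC⟩ := h.exists_velocity_approx
  refine ⟨C, fun t y x hx => ?_⟩
  obtain ⟨k, hk, hle⟩ := hC t y _ hx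
  refine ⟨-toSpace a +ᵥ k, ?_, ?_⟩
  · rw [CA.convexHull_relVelocities]
    exact Set.vadd_mem_vadd_set hk
  · convert hle using 2
    rw [toSpace_add, toSpace_nsmul, vadd_eq_add]
    module

lemma exists_attains_relVelocities (h : PeriodicIrreducible A η π σ) (a : Site d) :
    ∃ C : ℝ, ∀ k ∈ convexHull ℝ (A.relVelocities η π σ a : Set (EuclideanSpace ℝ (Fin d))),
      ∀ (t : ℕ) (y : Site d), ∃ x ∈ A.movingDefectSet η a {y} t,
        ‖toSpace x - toSpace y - (t : ℝ) • k‖ ≤ C := by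
  obtain ⟨C, hC⟩ := h.exists_attains
  refine ⟨C, fun k hk t y => ?_⟩
  rw [CA.convexHull_relVelocities] at hk
  obtain ⟨k, hk, rfl⟩ := hk
  obtain ⟨x, hx, hle⟩ := hC k hk t y
  refine ⟨x - t • a, ?_, ?_⟩
  · change x - t • a + t • a ∈ A.defectSet η {y} t
    rwa [sub_add_cancel]
  · convert hle using 2
    simp only [toSpace_sub, toSpace_nsmul, vadd_eq_add]
    module

end PeriodicIrreducible

end Moving

/-! ### Hausdorff limits for half-spaces and boxes -/

section Limits

lemma exists_lattice_approx (d : ℕ) : ∃ R : ℝ, ∀ p : EuclideanSpace ℝ (Fin d),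
    ∃ y : Site d, ‖toSpace y - p‖ ≤ R := by
  refine ⟨√d, fun p => ⟨fun i => ⌊p i⌋, ?_⟩⟩
  rw [EuclideanSpace.norm_eq]
  refine Real.sqrt_le_sqrt ?_
  refine (Finset.sum_le_card_nsmul Finset.univ _ 1 fun i _ => ?_).trans (by simp)
  rw [sq_le_one_iff_abs_le_one, abs_norm, Real.norm_eq_abs, abs_le]
  simp only [toSpace, PiLp.sub_apply]
  constructor <;> linarith [Int.floor_le (p i), Int.lt_floor_add_one (p i)]

/-- Sets at bounded distance from the dilations of `W` have rescaled Hausdorff limit `W`. -/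
lemma hausdorffLimit_of_bounded {S : ℕ → Set (Site d)} {W : Set (EuclideanSpace ℝ (Fin d))}
    {C₁ C₂ : ℝ}
    (h₁ : ∀ t : ℕ, 0 < t → ∀ x ∈ S t, ∃ p ∈ W, ‖toSpace x - (t : ℝ) • p‖ ≤ C₁)
    (h₂ : ∀ t : ℕ, 0 < t → ∀ p ∈ W, ∃ x ∈ S t, ‖toSpace x - (t : ℝ) • p‖ ≤ C₂) :
    HausdorffLimit S W := by
  set C := max C₁ C₂
  have hlim : Tendsto (fun t : ℕ => ENNReal.ofReal (C / t)) atTop (𝓝 0) := by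
    have := ENNReal.tendsto_ofReal (tendsto_const_div_atTop_nhds_zero_nat C)
    simpa using this
  have hdist : ∀ t : ℕ, 0 < t → ∀ (x : Site d) (p : EuclideanSpace ℝ (Fin d)),
      ‖toSpace x - (t : ℝ) • p‖ ≤ C → edist ((t : ℝ)⁻¹ • toSpace x) p ≤ ENNReal.ofReal (C / t) := by
    intro t ht x p hxp
    have htR : (0 : ℝ) < t := by exact_mod_cast ht
    rw [edist_dist]
    refine ENNReal.ofReal_le_ofReal ?_
    have e : (t : ℝ)⁻¹ • toSpace x - p = (t : ℝ)⁻¹ • (toSpace x - (t : ℝ) • p) := by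
      rw [smul_sub, inv_smul_smul₀ htR.ne']
    rw [dist_eq_norm, e, norm_smul, norm_inv, Real.norm_natCast, div_eq_inv_mul]
    gcongr
  refine tendsto_of_tendsto_of_tendsto_of_le_of_le' tendsto_const_nhds hlim
    (Eventually.of_forall fun _ => zero_le) ?_
  filter_upwards [eventually_gt_atTop 0] with t ht
  refine Metric.hausdorffEDist_le_of_mem_edist ?_ ?_
  · rintro _ ⟨x, hx, rfl⟩
    obtain ⟨p, hp, hle⟩ := h₁ t ht x hx
    exact ⟨p, hp, hdist t ht x p (hle.trans (le_max_left _ _))⟩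
  · intro p hp
    obtain ⟨x, hx, hle⟩ := h₂ t ht p hp
    refine ⟨_, ⟨x, hx, rfl⟩, ?_⟩
    rw [edist_comm]
    exact hdist t ht x p (hle.trans (le_max_right _ _))

variable {A : CA d} {η : Config d} {π σ : ℕ}

namespace PeriodicIrreducible

/-- The half-space velocity in the frame moving by `a`. -/
def halfSpaceVelocity (h : PeriodicIrreducible A η π σ) (a : Site d) (u : Dir d) : ℝ :=
  supportFun (A.relVelocities η π σ a) (h.relVelocities_nonempty a) u

/-- If w(u) ≤ 0, the defects started at the origin would satisfy ⟨x, u⟩ ≤ C at all times in the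
moving frame, and could not visit every site. -/
lemma halfSpaceVelocity_pos (h : PeriodicIrreducible A η π σ) {a : Site d}
    (hstrong : A.IsStronglyIrreducible η a) (u : Dir d) : 0 < h.halfSpaceVelocity a u := by
  by_contra! hw
  obtain ⟨C, hC⟩ := h.exists_relVelocity_approx a
  obtain ⟨R, hR⟩ := exists_lattice_approx d
  have hu : ‖(u : EuclideanSpace ℝ (Fin d))‖ = 1 := by simp
  -- Rounding loses at most R, so ⟨z, u⟩ ≥ C + 1.
  obtain ⟨z, hz⟩ := hR ((C + R + 1) • (u : EuclideanSpace ℝ (Fin d)))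
  have hzt : z ∈ ⋃ t : ℕ, A.movingDefectSet η a {0} t := by
    rw [hstrong 0]
    exact Set.mem_univ z
  obtain ⟨t, ht⟩ := Set.mem_iUnion.1 hzt
  obtain ⟨k, hk, hle⟩ := hC t 0 z ht
  have h1 := (real_inner_le_norm _ (u : EuclideanSpace ℝ (Fin d))).trans
    (mul_le_mul_of_nonneg_right hle (norm_nonneg _))
  have h2 := (abs_le.1 ((abs_real_inner_le_norm _ (u : EuclideanSpace ℝ (Fin d))).trans
    (mul_le_mul_of_nonneg_right hz (norm_nonneg _)))).1
  have h3 : inner ℝ k (u : EuclideanSpace ℝ (Fin d)) ≤ 0 :=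
    (inner_le_supportFun (hV := h.relVelocities_nonempty a) hk _).trans hw
  simp only [toSpace_zero, sub_zero, inner_sub_left, real_inner_smul_left, hu, mul_one,
    real_inner_self_eq_norm_sq, one_pow] at h1 h2
  nlinarith [mul_nonpos_of_nonneg_of_nonpos (Nat.cast_nonneg (α := ℝ) t) h3]

lemma hausdorffLimit_halfSpace (h : PeriodicIrreducible A η π σ) (a : Site d) (u : Dir d) :
    HausdorffLimit (A.movingDefectSet η a (latticeHalfSpace u))
      ((fun x => h.halfSpaceVelocity a u • (u : EuclideanSpace ℝ (Fin d)) + x) '' halfSpace u) := by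
  obtain ⟨C₁, hC₁⟩ := h.exists_relVelocity_approx a
  obtain ⟨C₂, hC₂⟩ := h.exists_attains_relVelocities a
  obtain ⟨R, hR⟩ := exists_lattice_approx d
  have hu : ‖(u : EuclideanSpace ℝ (Fin d))‖ = 1 := by simp
  have hR0 : 0 ≤ R := by
    obtain ⟨y, hy⟩ := hR 0
    exact (norm_nonneg _).trans hy
  set w := h.halfSpaceVelocity a u
  refine hausdorffLimit_of_bounded (C₁ := C₁) (C₂ := C₂ + R + R) ?_ ?_
  · intro t ht x hx
    have htR : (0 : ℝ) < t := by exact_mod_cast ht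
    obtain ⟨y, hy, hxy⟩ := (A.mem_movingDefectSet_iff η a _ t x).1 hx
    obtain ⟨k, hk, hle⟩ := hC₁ t y x hxy
    have hy' : inner ℝ (toSpace y) (u : EuclideanSpace ℝ (Fin d)) ≤ 0 := hy
    have hk' : inner ℝ k (u : EuclideanSpace ℝ (Fin d)) ≤ w :=
      inner_le_supportFun (hV := h.relVelocities_nonempty a) hk _
    refine ⟨_, ⟨(t : ℝ)⁻¹ • toSpace y + k - w • (u : EuclideanSpace ℝ (Fin d)), ?_, rfl⟩, ?_⟩
    · change inner ℝ _ _ ≤ (0 : ℝ)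
      rw [inner_sub_left, inner_add_left, real_inner_smul_left, real_inner_smul_left,
        real_inner_self_eq_norm_sq, hu]
      have := mul_nonpos_of_nonneg_of_nonpos (inv_pos.2 htR).le hy'
      linarith
    · convert hle using 2
      simp only [add_sub_cancel, smul_add, smul_inv_smul₀ htR.ne']
      abel
  · rintro t ht _ ⟨p, hp, rfl⟩
    have hp' : inner ℝ p (u : EuclideanSpace ℝ (Fin d)) ≤ 0 := hp
    obtain ⟨k, hk, hkw⟩ := exists_inner_eq_supportFun (h.relVelocities_nonempty a)
      (u : EuclideanSpace ℝ (Fin d))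
    change inner ℝ k _ = w at hkw
    -- Trace back from the target with a velocity `k` maximal in direction u; the extra shift by -R
    -- u keeps the starting point in the half-space after rounding to the lattice.
    obtain ⟨y, hy⟩ := hR ((t : ℝ) • (w • (u : EuclideanSpace ℝ (Fin d)) + p) - (t : ℝ) • k
      - R • (u : EuclideanSpace ℝ (Fin d)))
    have hyu : y ∈ latticeHalfSpace u := by
      change inner ℝ _ _ ≤ (0 : ℝ)
      have h1 := (real_inner_le_norm _ (u : EuclideanSpace ℝ (Fin d))).trans
        (mul_le_mul_of_nonneg_right hy (norm_nonneg _))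
      simp only [inner_sub_left, inner_add_left, real_inner_smul_left, hu, mul_one, hkw,
        real_inner_self_eq_norm_sq, one_pow] at h1
      nlinarith [mul_nonpos_of_nonneg_of_nonpos (Nat.cast_nonneg (α := ℝ) t) hp']
    obtain ⟨x, hx, hle⟩ := hC₂ k (subset_convexHull ℝ _ hk) t y
    refine ⟨x, (A.mem_movingDefectSet_iff η a _ t x).2 ⟨y, hyu, hx⟩, ?_⟩
    have e : toSpace x - (t : ℝ) • (w • (u : EuclideanSpace ℝ (Fin d)) + p) =
        (toSpace x - toSpace y - (t : ℝ) • k) +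
        (toSpace y - ((t : ℝ) • (w • (u : EuclideanSpace ℝ (Fin d)) + p) - (t : ℝ) • k
          - R • (u : EuclideanSpace ℝ (Fin d)))) - R • (u : EuclideanSpace ℝ (Fin d)) := by
      abel
    have hRu : ‖R • (u : EuclideanSpace ℝ (Fin d))‖ ≤ R := by
      rw [norm_smul, hu, mul_one, Real.norm_of_nonneg hR0]
    rw [e]
    exact (norm_sub_le _ _).trans
      (add_le_add ((norm_add_le _ _).trans (add_le_add hle hy)) hRu)

lemma finite_box (c : Site d) (σ : ℕ) : (box c σ).Finite :=
  (Set.finite_Icc c (fun i => c i + σ)).subset fun _ hx =>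
    ⟨fun i => (hx i).1, fun i => (hx i).2.le⟩

/-- The box is finite and contains `c`, so it behaves like a single initial defect up to a bounded
error. -/
lemma isDefectShape_box (h : PeriodicIrreducible A η π σ) (a c : Site d) :
    IsDefectShape (A.movingDefectSet η a (box c σ))
      (convexHull ℝ (A.relVelocities η π σ a : Set (EuclideanSpace ℝ (Fin d)))) := by
  have hc : c ∈ box c σ := fun i =>
    ⟨le_rfl, lt_add_of_pos_right _ (by exact_mod_cast h.space_pos)⟩
  obtain ⟨C₁, hC₁⟩ := h.exists_relVelocity_approx a
  obtain ⟨C₂, hC₂⟩ := h.exists_attains_relVelocities a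
  have hne := h.relVelocities_nonempty a
  refine Or.inr ⟨fun t => ?_, (Finset.finite_toSet _).isClosed_convexHull ℝ, ?_⟩
  · obtain ⟨k, hk⟩ := hne
    obtain ⟨x, hx, -⟩ := hC₂ k (subset_convexHull ℝ _ hk) t c
    exact ⟨x, (A.mem_movingDefectSet_iff η a _ t x).2 ⟨c, hc, hx⟩⟩
  obtain ⟨B, hB⟩ := ((finite_box c σ).image fun y => ‖toSpace y‖).bddAbove
  refine hausdorffLimit_of_bounded (C₁ := C₁ + B) (C₂ := C₂ + ‖toSpace c‖) ?_ ?_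
  · intro t _ x hx
    obtain ⟨y, hy, hxy⟩ := (A.mem_movingDefectSet_iff η a _ t x).1 hx
    obtain ⟨k, hk, hle⟩ := hC₁ t y x hxy
    refine ⟨k, hk, ?_⟩
    rw [show toSpace x - (t : ℝ) • k = (toSpace x - toSpace y - (t : ℝ) • k) + toSpace y by abel]
    exact (norm_add_le _ _).trans (add_le_add hle (hB ⟨y, hy, rfl⟩))
  · intro t _ k hk
    obtain ⟨x, hx, hle⟩ := hC₂ k hk t c
    refine ⟨x, (A.mem_movingDefectSet_iff η a _ t x).2 ⟨c, hc, hx⟩, ?_⟩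
    rw [show toSpace x - (t : ℝ) • k = (toSpace x - toSpace c - (t : ℝ) • k) + toSpace c by abel]
    exact (norm_add_le _ _).trans (add_le_add hle le_rfl)

end PeriodicIrreducible

end Limits

end DefectCA

end
theorem mainTheorem3 (d : ℕ) (hd : 1 ≤ d) (A : DefectCA.CA d) (η : DefectCA.Config d)
    (π σ : ℕ) (a : DefectCA.Site d)
    (hper : A.IsDoublyPeriodic η π σ)
    (hirr : A.IsIrreducible η π σ)
    (hstrong : A.IsStronglyIrreducible η a) :
    ∃ w : DefectCA.Dir d → ℝ,
      (∀ u : DefectCA.Dir d, 0 ≤ w u ∧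
        DefectCA.HausdorffLimit
          (A.movingDefectSet η a (DefectCA.latticeHalfSpace u))
          ((fun x => w u • (u : EuclideanSpace ℝ (Fin d)) + x) '' DefectCA.halfSpace u)) ∧
      (∀ c : DefectCA.Site d,
        DefectCA.IsDefectShape
          (A.movingDefectSet η a (DefectCA.box c σ))
          (DefectCA.polarTransform (DefectCA.frankDiagram w))) ∧
      DefectCA.polarTransform (DefectCA.frankDiagram w) =
        {x | ∀ u : DefectCA.Dir d, inner ℝ x (u : EuclideanSpace ℝ (Fin d)) ≤ w u} ∧
      DefectCA.IsConvexPolytope (DefectCA.frankDiagram w) := by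
  have h := hper.periodicIrreducible hirr
  have hpos := h.halfSpaceVelocity_pos hstrong
  have hpolar := DefectCA.polarTransform_frankDiagram hpos
  refine ⟨h.halfSpaceVelocity a, fun u => ⟨(hpos u).le, h.hausdorffLimit_halfSpace a u⟩,
    fun c => ?_, hpolar, DefectCA.isConvexPolytope_frankDiagram hd hpos⟩
  -- The box result gives the hull of the relative velocities; it equals the polar because a
  -- polytope is cut out by its support function.
  have hW : DefectCA.polarTransform (DefectCA.frankDiagram (h.halfSpaceVelocity a)) =
      convexHull ℝ (A.relVelocities η π σ a : Set (EuclideanSpace ℝ (Fin d))) := by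
    rw [hpolar]
    ext x
    rw [DefectCA.mem_convexHull_iff_inner_le (hV := h.relVelocities_nonempty a)]
    exact Subtype.forall
  rw [hW]
  exact h.isDefectShape_box a c
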